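/- Let $X=[0,1]^{\mathbb N_0}$ with the metric $d_X(x,y)=\sum_{i\ge 0}|x_i-y_i|/2^{i+1}$ and the shift $\sigma(x)_i=x_{i+1}$; write $a^\infty=aaa\ldots$ for $a\in[0,1]$. For a continuous $\varphi:X\to\mathbb R$ let $$\alpha_\varphi=\inf_\mu\int\varphi\,d\mu,$$ the infimum being over all $\sigma$-invariant Borel probability measures on $X$. The Mather set of $\varphi$ is the union of the supports of all $\sigma$-invariant Borel probability measures $\mu$ with $\int\varphi\,d\mu=\alpha_\varphi$. For $x,y\in X$, $n\ge 1$, $\varepsilon>0$ let $B(x,y,n;\varepsilon)=\{z\in X: d_X(x,z)<\varepsilon,\ d_X(\sigma^n z,y)<\varepsilon\}$, and set $$S_\varphi(x,y)=\lim_{\varepsilon\to0}\ \inf\Big\{\sum_{i=0}^{n-1}(\varphi(\sigma^i z)-\alpha_\varphi): n\ge 1,\ z\in B(x,y,n;\varepsilon)\Big\},$$ $$H_\varphi(x,y)=\lim_{\varepsilon\to0}\ \liminf_{n\to\infty}\ \inf\Big\{\sum_{i=0}^{n-1}(\varphi(\sigma^i z)-\alpha_\varphi): z\in B(x,y,n;\varepsilon)\Big\}.$$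 The Aubry set of $\varphi$ is $\{x\in X: S_\varphi(x,x)=0\}$, and $H_\varphi$ is the Peierls barrier. A calibrated subaction of $\varphi$ is a continuous $u:X\to\mathbb R$ with $u(x)+\varphi(x)\ge u(\sigma x)+\alpha_\varphi$ and $\min_{\sigma(y)=x}(\varphi(y)+u(y))=u(x)+\alpha_\varphi$ for all $x\in X$. For an integer $r\ge 2$ let $\mathscr H^r=\{h\in C^r([0,1]^2;\mathbb R): D_2D_1h<0 \text{ on } [0,1]^2\}$, with the topology of the $C^r$-norm. **Theorem.** Let $r\ge2$ be an integer. (i) There is an open dense subset $\mathscr O$ of $\mathscr H^r$ such that for every $h\in\mathscr O$, with $\varphi(x)=h(x_0,x_1)$, there is $a\in[0,1]$ such that the Mather set and the Aubry set of $\varphi$ are both equal to $\{a^\infty\}$, the function $y\mapsto H_\varphi(a^\infty,y)$ is finite on $X$ and is a calibrated subaction of $\varphi$, and every calibrated subaction of $\varphi$ differs from it by a constant. (ii) For every $h\in\mathscr H^r$ there is an open dense subset $\mathscr V_h$ of $C^r([0,1];\mathbb R)$ (with the $C^r$-norm) such that for every $V\in\mathscr V_h$ the same conclusion holds for $\varphi(x)=h(x_0,x_1)+V(x_0)$: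 for some $a\in[0,1]$ the Mather set and the Aubry set of $\varphi$ are both equal to $\{a^\infty\}$, and $y\mapsto H_\varphi(a^\infty,y)$ is finite and is, up to adding a constant, the unique calibrated subaction of $\varphi$. -/

import Mathlib

open Set Filter Topology MeasureTheory

noncomputable section

namespace XYModel

/-! ### The XY model -/

/-- The phase space `[0,1]^{ℕ₀}`, with the product topology (which is the topology of the metric
`dX`, see `hasBasis_nhds_dX`) and the product (that is, Borel) σ-algebra. -/
abbrev X : Type := ℕ → unitInterval

/-- The metric `d_X(x, y) = ∑ |x_i - y_i| / 2^{i+1}`. -/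
def dX (x y : X) : ℝ := ∑' i : ℕ, |(x i : ℝ) - (y i : ℝ)| / 2 ^ (i + 1)

/-- The shift `σ(x)_i = x_{i+1}`. -/
def shift (x : X) : X := fun i => x (i + 1)

/-- The fixed point `a^∞ = aaa…`. -/
def constSeq (a : unitInterval) : X := fun _ => a

/-- `μ` is a shift-invariant Borel probability measure. -/
def IsInvariantProb (μ : Measure X) : Prop :=
  IsProbabilityMeasure μ ∧ MeasurePreserving shift μ μ

/-- The optimal ergodic average `α_φ`, the infimum of `∫ φ dμ` over invariant probabilities. -/
def optAvg (φ : X → ℝ) : ℝ :=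
  sInf {c : ℝ | ∃ μ : Measure X, IsInvariantProb μ ∧ c = ∫ x, φ x ∂μ}

/-- `μ` is an optimizing (minimizing) measure for `φ`. -/
def IsMinimizing (φ : X → ℝ) (μ : Measure X) : Prop :=
  IsInvariantProb μ ∧ ∫ x, φ x ∂μ = optAvg φ

/-- The support of `μ`: the intersection of all compact sets of full measure. -/
def supp (μ : Measure X) : Set X := ⋂₀ {K : Set X | IsCompact K ∧ μ Kᶜ = 0}

/-- The Mather set: the union of the supports of all optimizing measures. -/
def matherSet (φ : X → ℝ) : Set X := {x | ∃ μ : Measure X, IsMinimizing φ μ ∧ x ∈ supp μ}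

/-- The normalized Birkhoff sum `∑_{i<n} (φ(σ^i z) - α_φ)`. -/
def action (φ : X → ℝ) (n : ℕ) (z : X) : ℝ :=
  ∑ i ∈ Finset.range n, (φ (shift^[i] z) - optAvg φ)

/-- `B(x, y, n; ε)`: the points `ε`-close to `x` whose `n`-th iterate is `ε`-close to `y`. -/
def connSet (x y : X) (n : ℕ) (ε : ℝ) : Set X :=
  {z | dX x z < ε ∧ dX (shift^[n] z) y < ε}

/-- `S_φ(x, y; ε)`, the infimum over all `n ≥ 1`, as an extended real (`inf ∅ = +∞`). -/
def manePotentialAt (φ : X → ℝ) (x y : X) (ε : ℝ) : EReal :=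
  ⨅ (n : ℕ) (_ : 1 ≤ n) (z : X) (_ : z ∈ connSet x y n ε), (action φ n z : EReal)

/-- The Mañé potential `S_φ(x, y) = lim_{ε → 0} S_φ(x, y; ε)`. The limit of this monotone family
is written as a supremum, see `tendsto_manePotential`. -/
def manePotential (φ : X → ℝ) (x y : X) : EReal :=
  ⨆ (ε : ℝ) (_ : 0 < ε), manePotentialAt φ x y ε

/-- The Aubry set `Ω_φ = {x | S_φ(x, x) = 0}`. -/
def aubrySet (φ : X → ℝ) : Set X := {x | manePotential φ x x = 0}

/-- `H_φ(x, y; ε) = liminf_{n → ∞} inf_{z ∈ B(x, y, n; ε)} ∑_{i<n} (φ(σ^i z) - α_φ)`. -/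
def peierlsBarrierAt (φ : X → ℝ) (x y : X) (ε : ℝ) : EReal :=
  liminf (fun n : ℕ => ⨅ (z : X) (_ : z ∈ connSet x y n ε), (action φ n z : EReal)) atTop

/-- The Peierls barrier `H_φ(x, y) = lim_{ε → 0} H_φ(x, y; ε)`. The limit of this monotone family
is written as a supremum, see `tendsto_peierlsBarrier`. -/
def peierlsBarrier (φ : X → ℝ) (x y : X) : EReal :=
  ⨆ (ε : ℝ) (_ : 0 < ε), peierlsBarrierAt φ x y ε

/-- A subaction of `φ`: a continuous `u` with `u(x) + φ(x) ≥ u(σ x) + α_φ`. -/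
def IsSubaction (φ u : X → ℝ) : Prop :=
  Continuous u ∧ ∀ x, u (shift x) + optAvg φ ≤ u x + φ x

/-- A calibrated subaction of `φ`: a subaction with
`min_{σ(y) = x} (φ(y) + u(y)) = u(x) + α_φ` for every `x`. -/
def IsCalibratedSubaction (φ u : X → ℝ) : Prop :=
  IsSubaction φ u ∧
    ∀ x, IsLeast ((fun y => φ y + u y) '' {y | shift y = x}) (u x + optAvg φ)

/-- The Mather set and the Aubry set of `φ` are one and the same fixed point `a^∞`, and
`y ↦ H_φ(a^∞, y)` is finite and is the unique calibrated subaction of `φ` up to constants. -/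
def HasUniqueCalibratedSubaction (φ : X → ℝ) : Prop :=
  ∃ a : unitInterval,
    matherSet φ = {constSeq a} ∧ aubrySet φ = {constSeq a} ∧
    ∃ u : X → ℝ, (∀ y, peierlsBarrier φ (constSeq a) y = (u y : EReal)) ∧
      IsCalibratedSubaction φ u ∧
      ∀ v : X → ℝ, IsCalibratedSubaction φ v → ∃ c : ℝ, ∀ y, v y = u y + c

/-! The two monotone limits, and the topology of `dX`. -/

theorem connSet_mono (x y : X) (n : ℕ) {ε δ : ℝ} (h : ε ≤ δ) :
    connSet x y n ε ⊆ connSet x y n δ :=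
  fun _ hz => ⟨hz.1.trans_le h, hz.2.trans_le h⟩

theorem antitone_manePotentialAt (φ : X → ℝ) (x y : X) : Antitone (manePotentialAt φ x y) :=
  fun _ _ h => iInf_mono fun n => iInf_mono fun _ =>
    iInf_mono fun _ => iInf_mono' fun hz => ⟨connSet_mono x y n h hz, le_rfl⟩

theorem tendsto_manePotential (φ : X → ℝ) (x y : X) :
    Tendsto (manePotentialAt φ x y) (𝓝[>] 0) (𝓝 (manePotential φ x y)) := by
  have h := (antitone_manePotentialAt φ x y).tendsto_nhdsGT 0
  rwa [sSup_image] at h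

theorem antitone_peierlsBarrierAt (φ : X → ℝ) (x y : X) : Antitone (peierlsBarrierAt φ x y) :=
  fun _ _ h => liminf_le_liminf (Eventually.of_forall fun n =>
    iInf_mono fun _ => iInf_mono' fun hz => ⟨connSet_mono x y n h hz, le_rfl⟩)

theorem tendsto_peierlsBarrier (φ : X → ℝ) (x y : X) :
    Tendsto (peierlsBarrierAt φ x y) (𝓝[>] 0) (𝓝 (peierlsBarrier φ x y)) := by
  have h := (antitone_peierlsBarrierAt φ x y).tendsto_nhdsGT 0
  rwa [sSup_image] at h

theorem abs_sub_coord_le_one (x y : X) (i : ℕ) : |(x i : ℝ) - (y i : ℝ)| ≤ 1 := by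
  have h1 := (x i).2.1
  have h2 := (x i).2.2
  have h3 := (y i).2.1
  have h4 := (y i).2.2
  rw [abs_le]
  constructor <;> linarith

theorem term_dX_le (x y : X) (i : ℕ) :
    |(x i : ℝ) - (y i : ℝ)| / 2 ^ (i + 1) ≤ 1 / 2 / 2 ^ i := by
  rw [div_div, ← pow_succ']
  gcongr
  exact abs_sub_coord_le_one x y i

theorem summable_dX (x y : X) :
    Summable fun i : ℕ => |(x i : ℝ) - (y i : ℝ)| / 2 ^ (i + 1) :=
  Summable.of_nonneg_of_le (fun _ => by positivity) (term_dX_le x y)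
    (summable_geometric_two' 1)

theorem continuous_dX (x : X) : Continuous (dX x) := by
  refine continuous_tsum (fun i => ?_) (summable_geometric_two' 1) (fun i y => ?_)
  · fun_prop
  · rw [Real.norm_of_nonneg (by positivity)]
    exact term_dX_le x y i

/-- The `dX`-balls form a neighbourhood basis for the product topology. -/
theorem hasBasis_nhds_dX (x : X) :
    (𝓝 x).HasBasis (fun ε : ℝ => 0 < ε) (fun ε => {y | dX x y < ε}) := by
  refine ⟨fun t => ⟨fun ht => ?_, ?_⟩⟩
  · rw [nhds_pi, Filter.mem_pi] at ht
    obtain ⟨I, hI, s, hs, hst⟩ := ht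
    choose δ hδ hδs using fun i => Metric.mem_nhds_iff.1 (hs i)
    obtain ⟨ε, hε, hεI⟩ : ∃ ε : ℝ, 0 < ε ∧ ∀ i ∈ I, ε ≤ δ i / 2 ^ (i + 1) := by
      have hev : ∀ᶠ ε : ℝ in 𝓝[>] 0, ∀ i ∈ I, ε ≤ δ i / 2 ^ (i + 1) := by
        rw [hI.eventually_all]
        intro i _
        have hpos : 0 < δ i / 2 ^ (i + 1) := by have := hδ i; positivity
        exact nhdsWithin_le_nhds (Iic_mem_nhds hpos)
      exact (eventually_mem_nhdsWithin.and hev).exists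
    refine ⟨ε, hε, fun y hy => hst fun i hi => hδs i ?_⟩
    have h1 : |(x i : ℝ) - (y i : ℝ)| / 2 ^ (i + 1) ≤ dX x y :=
      (summable_dX x y).le_tsum i fun j _ => by positivity
    have h2 := (h1.trans_lt hy).trans_le (hεI i hi)
    rw [div_lt_div_iff_of_pos_right (by positivity)] at h2
    rw [Metric.mem_ball, dist_comm, Subtype.dist_eq, Real.dist_eq]
    exact h2
  · rintro ⟨ε, hε, hεt⟩
    refine mem_of_superset ((isOpen_lt (continuous_dX x) continuous_const).mem_nhds ?_) hεt
    simpa [dX] using hε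

/-! ### Spaces of `C^r` functions on a compact set -/

/-- Extension by `0` of a function on `K`; only its values on `K` are ever used. -/
def ext0 {E : Type*} {K : Set E} (f : K → ℝ) : E → ℝ := Function.extend Subtype.val f 0

theorem ext0_coe {E : Type*} {K : Set E} (f : K → ℝ) (x : K) : ext0 f x = f x :=
  Subtype.val_injective.extend_apply f 0 x

section Cr

variable {E : Type*} [NormedAddCommGroup E] [NormedSpace ℝ E]

/-- `C^r(K; ℝ)`: the functions `K → ℝ` that are `r` times continuously differentiable on `K`
(with derivatives within `K`, hence up to the boundary). -/
def CrMap (r : ℕ) (K : Set E) : Type _ := {f : K → ℝ // ContDiffOn ℝ r (ext0 f) K}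

/-- The derivatives of orders `0, …, r` of `f`, as continuous functions on `K`. -/
def CrMap.jet {r : ℕ} {K : Set E} [hK : Fact (UniqueDiffOn ℝ K)] (f : CrMap r K)
    (k : Fin (r + 1)) : C(K, E [×(k : ℕ)]→L[ℝ] ℝ) where
  toFun x := iteratedFDerivWithin ℝ k (ext0 f.1) K x
  continuous_toFun := continuousOn_iff_continuous_domRestrict.1
    (f.2.continuousOn_iteratedFDerivWithin (by exact_mod_cast Nat.lt_succ_iff.1 k.2) hK.out)

/-- The distance `‖f - g‖_{C^r}`, where `‖f‖_{C^r} = max_{k ≤ r} sup_K ‖D^k f‖`. -/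
instance {r : ℕ} {K : Set E} [Fact (UniqueDiffOn ℝ K)] [CompactSpace K] :
    PseudoMetricSpace (CrMap r K) :=
  PseudoMetricSpace.induced CrMap.jet inferInstance

end Cr

/-- The square `[0,1]²`. -/
abbrev square : Set (ℝ × ℝ) := Icc (0 : ℝ) 1 ×ˢ Icc (0 : ℝ) 1

instance : CompactSpace square := isCompact_iff_compactSpace.1 (isCompact_Icc.prod isCompact_Icc)

instance : Fact (UniqueDiffOn ℝ (Icc (0 : ℝ) 1)) := ⟨uniqueDiffOn_Icc_zero_one⟩

instance : Fact (UniqueDiffOn ℝ square) :=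
  ⟨uniqueDiffOn_Icc_zero_one.prod uniqueDiffOn_Icc_zero_one⟩

/-- The partial derivative `D₁h` on the square (one-sided at the boundary). -/
def D1 (h : ℝ × ℝ → ℝ) (p : ℝ × ℝ) : ℝ :=
  derivWithin (fun s => h (s, p.2)) (Icc 0 1) p.1

/-- The partial derivative `D₂h` on the square (one-sided at the boundary). -/
def D2 (h : ℝ × ℝ → ℝ) (p : ℝ × ℝ) : ℝ :=
  derivWithin (fun t => h (p.1, t)) (Icc 0 1) p.2

/-- The space `ℋ^r` of functions in `C^r([0,1]²; ℝ)` with the twist condition `D₂D₁h < 0`, with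
the topology of the `C^r`-norm. -/
abbrev TwistSpace (r : ℕ) : Type :=
  {h : CrMap r square // ∀ p ∈ square, D2 (D1 (ext0 h.1)) p < 0}

/-- The potential `φ(x) = h(x₀, x₁)`. -/
def potential {r : ℕ} (h : CrMap r square) (x : X) : ℝ :=
  h.1 ⟨((x 0 : ℝ), (x 1 : ℝ)), (x 0).2, (x 1).2⟩

/-- The potential `φ(x) = h(x₀, x₁) + V(x₀)` of the perturbation `h + V`. -/
def perturbedPotential {r : ℕ} (h : CrMap r square) (V : CrMap r (Icc (0 : ℝ) 1)) (x : X) : ℝ :=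
  potential h x + V.1 (x 0)

end XYModel

end

open XYModel

namespace XYModel

/-! ### The shift, the metric and the action -/

/-! The twist condition reduces the problem to the diagonal. Put `U y = ∫₀^y D₁h(s,s) ds`. The
derivative in `x` of `h(x,y) - U(x)` is `D₁h(x,y) - D₁h(x,x)`, and since `D₁h(x,·)` is strictly
decreasing, this is negative for `x < y` and positive for `x > y`. Hence `h(x,y) - U(x) > h(y,y) -
U(y)` whenever `x ≠ y` (`exists_reduction`). If `t ↦ h(t,t)` has a unique minimum point `a`, then
`-U(x₀)` is a subaction at level `h(a,a)`, and equality in its inequality forces `x₀ = x₁ = a`. A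
term `V(x₀)` merely replaces `U` by `U + V` and the diagonal function by `h(t,t) + V(t)`.

Such a strict subaction decides everything. The nonnegative reduced potential `φ + U - U ∘ σ -
φ(a^∞)`, where `U` now denotes the subaction, has the same integrals as `φ - φ(a^∞)` against
invariant measures, so an optimal measure lives on `a^∞`; it also charges a fixed cost to any orbit
away from `x₀ = a`, which settles the Aubry set. A calibrated subaction exists as a Lax–Oleinik
fixed point (`exists_laxOleinik_fixed`). Its calibrated backward orbits converge to `a^∞`, so each
calibrated `v` satisfies `H(a^∞, y) = v(y) - v(a^∞)` (`IsStrictSubaction.peierlsBarrier_eq`), and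
uniqueness follows.

It remains that a unique diagonal minimum is generic. Adding `ε(t - a)²` at some minimum point `a`
creates quadratic growth, and then uniqueness survives `C²`-small perturbations
(`HasC2Derivs.exists_stable_min`). As a function of the first coordinate alone, this term preserves
the twist (`twist_perturb`). -/

theorem continuous_shift : Continuous shift :=
  continuous_pi fun i => continuous_apply (i + 1)

theorem shift_iterate_apply (n : ℕ) (x : X) (i : ℕ) : shift^[n] x i = x (i + n) := by
  induction n generalizing x with
  | zero => rfl
  | succ n ih =>
    rw [Function.iterate_succ_apply, ih]
    exact congrArg x (by omega)

theorem shift_constSeq (a : unitInterval) : shift (constSeq a) = constSeq a := rfl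

theorem shift_iterate_constSeq (a : unitInterval) (n : ℕ) :
    shift^[n] (constSeq a) = constSeq a :=
  Function.iterate_fixed (shift_constSeq a) n

theorem dX_self (x : X) : dX x x = 0 := by simp [dX]

theorem dX_comm (x y : X) : dX x y = dX y x := by
  simp only [dX, abs_sub_comm]

theorem abs_sub_lt_of_dX_lt {x y : X} {ε : ℝ} (h : dX x y < ε) (i : ℕ) :
    |(x i : ℝ) - (y i : ℝ)| < ε * 2 ^ (i + 1) := by
  have h1 : |(x i : ℝ) - (y i : ℝ)| / 2 ^ (i + 1) ≤ dX x y :=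
    (summable_dX x y).le_tsum i fun j _ => by positivity
  rw [← div_lt_iff₀ (by positivity)]
  exact h1.trans_lt h

theorem exists_forall_dX_lt {u : X → ℝ} (hu : Continuous u) (x : X) {η : ℝ} (hη : 0 < η) :
    ∃ ε > 0, ∀ z, dX x z < ε → |u z - u x| < η := by
  have h : {z | |u z - u x| < η} ∈ 𝓝 x :=
    (isOpen_lt (by fun_prop) continuous_const).mem_nhds (by simpa using hη)
  obtain ⟨ε, hε, hs⟩ := (hasBasis_nhds_dX x).mem_iff.1 h
  exact ⟨ε, hε, fun z hz => hs hz⟩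

/-- Along an orbit segment in `B(x, y, n; ε)` a continuous function varies by nearly
`u y - u x`. -/
theorem exists_forall_connSet {u : X → ℝ} (hu : Continuous u) (x y : X) {η : ℝ} (hη : 0 < η) :
    ∃ ε > 0, ∀ n, ∀ z ∈ connSet x y n ε, |(u (shift^[n] z) - u z) - (u y - u x)| < η := by
  obtain ⟨ε₁, h₁, H₁⟩ := exists_forall_dX_lt hu x (half_pos hη)
  obtain ⟨ε₂, h₂, H₂⟩ := exists_forall_dX_lt hu y (half_pos hη)
  refine ⟨min ε₁ ε₂, lt_min h₁ h₂, fun n z hz => ?_⟩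
  have a1 := abs_lt.1 (H₁ z (hz.1.trans_le (min_le_left _ _)))
  have a2 := abs_lt.1 (H₂ (shift^[n] z) (by rw [dX_comm]; exact hz.2.trans_le (min_le_right _ _)))
  rw [abs_lt]
  constructor <;> linarith [a1.1, a1.2, a2.1, a2.2]

theorem action_succ (φ : X → ℝ) (n : ℕ) (z : X) :
    action φ (n + 1) z = action φ n z + (φ (shift^[n] z) - optAvg φ) :=
  Finset.sum_range_succ _ _

theorem action_succ' (φ : X → ℝ) (n : ℕ) (z : X) :
    action φ (n + 1) z = (φ z - optAvg φ) + action φ n (shift z) := by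
  simp only [action, Finset.sum_range_succ', Function.iterate_succ_apply, Function.iterate_zero,
    id_eq, add_comm]

/-- Telescoping along the orbit. This supplies the lower bounds for both the Mañé potential and the
Peierls barrier. -/
theorem IsSubaction.sub_le_action {φ u : X → ℝ} (hu : IsSubaction φ u) (n : ℕ) (z : X) :
    u (shift^[n] z) - u z ≤ action φ n z := by
  induction n with
  | zero => simp [action]
  | succ n ih =>
    rw [action_succ, Function.iterate_succ_apply']
    linarith [hu.2 (shift^[n] z)]

theorem isInvariantProb_dirac (a : unitInterval) :
    IsInvariantProb (Measure.dirac (constSeq a)) := by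
  refine ⟨inferInstance, continuous_shift.measurable, ?_⟩
  rw [Measure.map_dirac' continuous_shift.measurable, shift_constSeq]

theorem integrable_of_continuous {μ : Measure X} [IsFiniteMeasure μ] {f : X → ℝ}
    (hf : Continuous f) : Integrable f μ :=
  hf.integrable_of_hasCompactSupport (HasCompactSupport.of_compactSpace f)

/-! ### Potentials with a strict subaction -/

/-- `U` is a subaction of `φ` at the level `φ(a^∞)`, and is strict away from `x₀ = a`. -/
structure IsStrictSubaction (φ U : X → ℝ) (a : unitInterval) : Prop where
  continuous_potential : Continuous φ
  continuous : Continuous U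
  le : ∀ x, φ (constSeq a) + U (shift x) ≤ φ x + U x
  eq : ∀ x, φ (constSeq a) + U (shift x) = φ x + U x → x 0 = a

namespace IsStrictSubaction

variable {φ U : X → ℝ} {a : unitInterval}

/-- The coboundary `U - U ∘ σ` has zero integral against an invariant measure. -/
theorem integral_reduced (h : IsStrictSubaction φ U a) {μ : Measure X} (hμ : IsInvariantProb μ) :
    ∫ x, (φ x + U x - (φ (constSeq a) + U (shift x))) ∂μ = ∫ x, φ x ∂μ - φ (constSeq a) := by
  have := hμ.1
  have i1 : Integrable φ μ := integrable_of_continuous h.continuous_potential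
  have i2 : Integrable U μ := integrable_of_continuous h.continuous
  have i3 : Integrable (fun x => U (shift x)) μ :=
    integrable_of_continuous (h.continuous.comp continuous_shift)
  have e : ∫ x, U (shift x) ∂μ = ∫ x, U x ∂μ := by
    conv_rhs => rw [← hμ.2.map_eq]
    rw [integral_map continuous_shift.aemeasurable h.continuous.aestronglyMeasurable]
  have e1 := integral_sub (i1.add i2) ((integrable_const (φ (constSeq a))).add i3)
  rw [integral_add' i1 i2, integral_add' (integrable_const _) i3, e] at e1
  refine e1.trans ?_
  simp

theorem optAvg_eq (h : IsStrictSubaction φ U a) : optAvg φ = φ (constSeq a) := by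
  refine IsLeast.csInf_eq ⟨⟨_, isInvariantProb_dirac a, by simp⟩, ?_⟩
  rintro c ⟨μ, hμ, rfl⟩
  have := h.integral_reduced hμ
  have h0 : 0 ≤ ∫ x, (φ x + U x - (φ (constSeq a) + U (shift x))) ∂μ :=
    integral_nonneg fun x => sub_nonneg.2 (h.le x)
  linarith

theorem isSubaction (h : IsStrictSubaction φ U a) : IsSubaction φ U :=
  ⟨h.continuous, fun x => by linarith [h.le x, h.optAvg_eq]⟩

/-- For a minimizing measure the nonnegative reduced potential has zero integral, so it vanishes
almost everywhere and `x₀ = a` almost surely; invariance carries this to every coordinate. -/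
theorem matherSet_eq (h : IsStrictSubaction φ U a) : matherSet φ = {constSeq a} := by
  refine Subset.antisymm ?_ ?_
  · rintro x ⟨μ, hμ, hx⟩
    have := hμ.1.1
    refine hx {constSeq a} ⟨isCompact_singleton, ?_⟩
    have h0 := h.integral_reduced hμ.1
    rw [hμ.2, h.optAvg_eq, sub_self] at h0
    have hc : Continuous fun x => φ x + U x - (φ (constSeq a) + U (shift x)) :=
      (h.continuous_potential.add h.continuous).sub
        (continuous_const.add (h.continuous.comp continuous_shift))
    have hae := (integral_eq_zero_iff_of_nonneg (fun x => sub_nonneg.2 (h.le x))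
      (integrable_of_continuous hc)).1 h0
    have hae0 : ∀ᵐ x ∂μ, x 0 = a := by
      filter_upwards [hae] with x hx
      exact h.eq x (sub_eq_zero.1 hx).symm
    have hall : ∀ᵐ x ∂μ, ∀ k, x k = a := by
      rw [ae_all_iff]
      intro k
      filter_upwards [(hμ.1.2.iterate k).quasiMeasurePreserving.ae hae0] with x hx
      rwa [shift_iterate_apply, zero_add] at hx
    rw [← mem_ae_iff]
    filter_upwards [hall] with x hx
    exact funext hx
  · rintro _ rfl
    refine ⟨Measure.dirac (constSeq a), ⟨isInvariantProb_dirac a, ?_⟩, ?_⟩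
    · rw [h.optAvg_eq]
      simp
    · rintro K ⟨hK, hK0⟩
      by_contra hx
      rw [Measure.dirac_apply' _ hK.measurableSet.compl, indicator_of_mem (by exact hx)] at hK0
      simp at hK0

/-- The reduced potential is bounded below away from `x₀ = a`. -/
theorem exists_pos_le (h : IsStrictSubaction φ U a) {δ : ℝ} (hδ : 0 < δ) :
    ∃ κ > 0, ∀ x : X, δ ≤ |(x 0 : ℝ) - a| → κ ≤ φ x + U x - (φ (constSeq a) + U (shift x)) := by
  have hc : Continuous fun x => φ x + U x - (φ (constSeq a) + U (shift x)) :=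
    (h.continuous_potential.add h.continuous).sub
      (continuous_const.add (h.continuous.comp continuous_shift))
  have hK : IsCompact {x : X | δ ≤ |(x 0 : ℝ) - a|} :=
    (isClosed_le continuous_const (by fun_prop)).isCompact
  rcases eq_empty_or_nonempty {x : X | δ ≤ |(x 0 : ℝ) - a|} with he | hne
  · exact ⟨1, one_pos, fun x hx => absurd (show x ∈ {x : X | δ ≤ |(x 0 : ℝ) - a|} from hx)
      (by simp [he])⟩
  · obtain ⟨x, hx, hmin⟩ := hK.exists_isMinOn hne hc.continuousOn
    refine ⟨_, ?_, fun y hy => hmin hy⟩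
    refine (sub_nonneg.2 (h.le x)).lt_of_ne fun h0 => ?_
    have := h.eq x (sub_eq_zero.1 h0.symm).symm
    simp only [mem_ofPred_eq, this, sub_self, abs_zero] at hx
    linarith

/-- In the telescoped sum every reduced term is nonnegative; all are dropped except the one at time
`k`. -/
theorem sub_add_reduced_le_action (h : IsStrictSubaction φ U a) {k n : ℕ} (hk : k < n) (z : X) :
    U (shift^[n] z) - U z + (φ (shift^[k] z) + U (shift^[k] z)
      - (φ (constSeq a) + U (shift^[k + 1] z))) ≤ action φ n z := by
  induction n with
  | zero => omega
  | succ n ih =>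
    rw [action_succ]
    rcases Nat.lt_succ_iff_lt_or_eq.1 hk with hk | rfl
    · have := h.isSubaction.2 (shift^[n] z)
      rw [Function.iterate_succ_apply' shift n]
      linarith [ih hk]
    · have := h.isSubaction.sub_le_action k z
      rw [h.optAvg_eq]
      linarith

/-- A nearly closed orbit has almost no net change in `U`, so a visit away from `x₀ = a` leaves a
definite positive action. Conversely, the constant orbit has zero action, and the subaction bound
excludes negative values at `a^∞`. -/
theorem aubrySet_eq (h : IsStrictSubaction φ U a) : aubrySet φ = {constSeq a} := by
  refine Subset.antisymm ?_ ?_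
  · intro x hx
    refine funext fun k => ?_
    induction k using Nat.strong_induction_on with
    | _ k ih =>
    by_contra hne
    have hD : 0 < |(x k : ℝ) - a| := abs_pos.2 (sub_ne_zero.2 fun h => hne (Subtype.ext h))
    obtain ⟨κ, hκ, hle⟩ := h.exists_pos_le (half_pos hD)
    obtain ⟨ε₀, hε₀, H⟩ := exists_forall_connSet h.continuous x x (half_pos hκ)
    have hp : (0 : ℝ) < 2 ^ (k + 1) := by positivity
    -- The second bound makes `z k` closer to `x k` than half of `|x k - a|`; the first makes `U`
    -- nearly unchanged between the two ends of the segment.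
    set ε := min ε₀ (|(x k : ℝ) - a| / 2 / 2 ^ (k + 1)) with hεdef
    have hε : 0 < ε := lt_min hε₀ (by positivity)
    have hε2 : ε * 2 ^ (k + 1) ≤ |(x k : ℝ) - a| / 2 := by
      rw [← le_div_iff₀ hp]
      exact min_le_right _ _
    have hlt : manePotentialAt φ x x ε < ((κ / 2 : ℝ) : EReal) := by
      refine lt_of_le_of_lt (le_iSup₂_of_le (f := fun (ε : ℝ) (_ : 0 < ε) =>
        manePotentialAt φ x x ε) ε hε le_rfl) ?_
      rw [show (⨆ (ε : ℝ) (_ : 0 < ε), manePotentialAt φ x x ε) = 0 from hx]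
      exact_mod_cast half_pos hκ
    simp only [manePotentialAt, iInf_lt_iff] at hlt
    obtain ⟨n, hn, z, hz, hlt⟩ := hlt
    have hlt : action φ n z < κ / 2 := by exact_mod_cast hlt
    have hzk := (abs_sub_lt_of_dX_lt hz.1 k).trans_le hε2
    -- If `k < n`, the segment itself passes away from `a` at time `k` and pays `κ`. If `k ≥ n`,
    -- then `z k` is coordinate `k - n` of `σⁿ z`, close to `x (k - n)`, which is `a` by induction.
    rcases lt_or_ge k n with hkn | hkn
    · have h1 := h.sub_add_reduced_le_action hkn z
      have h2 := abs_lt.1 (H n z (connSet_mono x x n (min_le_left _ _) hz))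
      have h3 : |(x k : ℝ) - a| / 2 ≤ |((shift^[k] z) 0 : ℝ) - a| := by
        rw [shift_iterate_apply, zero_add]
        have := abs_sub_le (x k : ℝ) (z k) a
        linarith
      have h4 := hle _ h3
      rw [Function.iterate_succ_apply'] at h1
      linarith [h2.1]
    · have h1 := abs_sub_lt_of_dX_lt hz.2 (k - n)
      rw [shift_iterate_apply, Nat.sub_add_cancel hkn, ih (k - n) (by omega)] at h1
      have h2 : ε * 2 ^ (k - n + 1) ≤ ε * 2 ^ (k + 1) := by
        gcongr
        · norm_num
        · omega
      have h3 := abs_sub_le (x k : ℝ) (z k) a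
      change |(z k : ℝ) - a| < _ at h1
      linarith
  · rintro _ rfl
    refine le_antisymm (iSup₂_le fun ε hε => ?_) ?_
    · refine iInf₂_le_of_le 1 le_rfl (iInf₂_le_of_le (constSeq a) ?_ ?_)
      · exact ⟨by rwa [dX_self], by rwa [shift_iterate_constSeq, dX_self]⟩
      · simp [action, h.optAvg_eq]
    · refine le_of_forall_lt fun c hc => ?_
      obtain ⟨r, hr, hr0⟩ := EReal.lt_iff_exists_real_btwn.1 hc
      have hr0 : r < 0 := by exact_mod_cast hr0
      obtain ⟨ε, hε, H⟩ := exists_forall_connSet h.continuous (constSeq a) (constSeq a)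
        (neg_pos.2 hr0)
      refine hr.trans_le ((le_iInf₂ fun n _ => le_iInf₂ fun z hz => ?_).trans
        (le_iSup₂_of_le (f := fun (ε : ℝ) (_ : 0 < ε) =>
          manePotentialAt φ (constSeq a) (constSeq a) ε) ε hε le_rfl))
      have h1 := h.isSubaction.sub_le_action n z
      have h2 := abs_lt.1 (H n z hz)
      have : r ≤ action φ n z := by linarith [h2.1]
      exact_mod_cast this

/-- Calibrated backward orbits converge to `a^∞`. -/
theorem exists_backward_orbit (h : IsStrictSubaction φ U a) {v : X → ℝ}
    (hv : IsCalibratedSubaction φ v) (y : X) :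
    ∃ x : ℕ → X, (∀ n, shift^[n] (x n) = y) ∧ (∀ n, action φ n (x n) = v y - v (x n)) ∧
      Tendsto x atTop (𝓝 (constSeq a)) := by
  choose p hp hpv using fun x => (hv.2 x).1
  simp only [mem_ofPred_eq] at hp hpv
  let x : ℕ → X := fun n => p^[n] y
  have hs : ∀ n, shift (x (n + 1)) = x n := fun n => by
    simp only [x, Function.iterate_succ_apply', hp]
  have hxv : ∀ n, φ (x (n + 1)) + v (x (n + 1)) = v (x n) + optAvg φ := fun n => by
    simp only [x, Function.iterate_succ_apply', hpv]
  have hsi : ∀ j n, shift^[j] (x (n + j)) = x n := by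
    intro j n
    induction j with
    | zero => rfl
    | succ j ih => rw [Function.iterate_succ_apply, ← Nat.add_assoc, hs, ih]
  refine ⟨x, fun n => by simpa [x] using hsi n 0, fun n => ?_, ?_⟩
  · induction n with
    | zero => simp [action, x]
    | succ n ih =>
      rw [action_succ', hs, ih]
      linarith [hxv n]
  · obtain ⟨C, hC⟩ := isCompact_univ.exists_bound_of_continuousOn hv.1.1.continuousOn
    obtain ⟨D, hD⟩ := isCompact_univ.exists_bound_of_continuousOn h.continuous.continuousOn
    simp only [mem_univ, Real.norm_eq_abs, forall_const] at hC hD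
    set g : ℕ → ℝ := fun n =>
      φ (x (n + 1)) + U (x (n + 1)) - (φ (constSeq a) + U (shift (x (n + 1)))) with hg
    have hsum : ∀ n, ∑ k ∈ Finset.range n, g k = (v y - v (x n)) + (U (x n) - U y) := by
      intro n
      induction n with
      | zero => simp [x]
      | succ n ih =>
        rw [Finset.sum_range_succ, ih, hg]
        simp only [hs]
        linarith [hxv n, h.optAvg_eq]
    -- The nonnegative reduced costs have bounded partial sums because `v` and `U` are bounded; so
    -- they tend to zero.
    have hsm : Summable g := by
      refine summable_of_sum_range_le (c := 2 * C + 2 * D) (fun n => sub_nonneg.2 (h.le _))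
        fun n => ?_
      rw [hsum]
      have := abs_le.1 (hC y)
      have := abs_le.1 (hC (x n))
      have := abs_le.1 (hD y)
      have := abs_le.1 (hD (x n))
      linarith
    have ht0 : Tendsto (fun n => x n 0) atTop (𝓝 a) := by
      rw [← tendsto_add_atTop_iff_nat 1, Metric.tendsto_atTop]
      intro δ hδ
      obtain ⟨κ, hκ, hle⟩ := h.exists_pos_le hδ
      obtain ⟨N, hN⟩ := eventually_atTop.1 (hsm.tendsto_atTop_zero.eventually_lt_const hκ)
      refine ⟨N, fun n hn => ?_⟩
      by_contra! hcon
      exact absurd (hle (x (n + 1)) hcon) (not_le.2 (hN n hn))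
    -- Coordinate `j` of `x (n + j)` is coordinate `0` of `x n`, so convergence of the zeroth
    -- coordinates suffices.
    refine tendsto_pi_nhds.2 fun j => (tendsto_add_atTop_iff_nat j).1 ?_
    refine ht0.congr fun n => ?_
    rw [← hsi j n, shift_iterate_apply, zero_add]

/-- The calibrated backward orbit of `y` is a competitor with action exactly `v y - v (x n)` and
starts close to `a^∞`, giving `≤`. The subaction inequality for `v` gives `≥`. -/
theorem peierlsBarrier_eq (h : IsStrictSubaction φ U a) {v : X → ℝ}
    (hv : IsCalibratedSubaction φ v) (y : X) :
    peierlsBarrier φ (constSeq a) y = ((v y - v (constSeq a) : ℝ) : EReal) := by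
  refine le_antisymm (iSup₂_le fun ε hε => ?_) (le_of_forall_lt fun c hc => ?_)
  · obtain ⟨x, hx, hact, hlim⟩ := h.exists_backward_orbit hv y
    have hl : Tendsto (fun n => ((v y - v (x n) : ℝ) : EReal)) atTop
        (𝓝 ((v y - v (constSeq a) : ℝ) : EReal)) :=
      (continuous_coe_real_ereal.tendsto _).comp
        (tendsto_const_nhds.sub ((hv.1.1.tendsto _).comp hlim))
    rw [← hl.liminf_eq]
    refine liminf_le_liminf ?_
    filter_upwards [hlim ((hasBasis_nhds_dX (constSeq a)).mem_of_mem hε)] with n hn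
    refine iInf₂_le_of_le (x n) ⟨hn, ?_⟩ (by rw [hact])
    rwa [hx, dX_self]
  · obtain ⟨r, hr, hr0⟩ := EReal.lt_iff_exists_real_btwn.1 hc
    have hr0 : r < v y - v (constSeq a) := by exact_mod_cast hr0
    obtain ⟨ε, hε, H⟩ := exists_forall_connSet hv.1.1 (constSeq a) y (sub_pos.2 hr0)
    refine hr.trans_le (le_trans ?_ (le_iSup₂_of_le (f := fun (ε : ℝ) (_ : 0 < ε) =>
      peierlsBarrierAt φ (constSeq a) y ε) ε hε le_rfl))
    refine le_liminf_of_le (by isBoundedDefault) (Eventually.of_forall fun n => ?_)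
    refine le_iInf₂ fun z hz => ?_
    have h1 := hv.1.sub_le_action n z
    have h2 := abs_lt.1 (H n z hz)
    have : r ≤ action φ n z := by linarith [h2.1]
    exact_mod_cast this

theorem hasUniqueCalibratedSubaction (h : IsStrictSubaction φ U a) {v : X → ℝ}
    (hv : IsCalibratedSubaction φ v) : HasUniqueCalibratedSubaction φ := by
  refine ⟨a, h.matherSet_eq, h.aubrySet_eq, fun y => v y - v (constSeq a),
    fun y => h.peierlsBarrier_eq hv y, ⟨⟨by have := hv.1.1; fun_prop, fun x => ?_⟩, fun x => ?_⟩,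
    fun w hw => ⟨w (constSeq a), fun y => ?_⟩⟩
  · linarith [hv.1.2 x]
  · obtain ⟨⟨y, hy, hyv⟩, hlb⟩ := hv.2 x
    refine ⟨⟨y, hy, ?_⟩, ?_⟩
    · simp only at hyv ⊢
      linarith
    · rintro _ ⟨z, hz, rfl⟩
      have := hlb ⟨z, hz, rfl⟩
      simp only at this ⊢
      linarith
  · have e := (h.peierlsBarrier_eq hw y).symm.trans (h.peierlsBarrier_eq hv y)
    have e : w y - w (constSeq a) = v y - v (constSeq a) := by exact_mod_cast e
    linarith

end IsStrictSubaction

/-! ### Nearest neighbour potentials -/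

/-- Existence of a continuous fixed point of the Lax–Oleinik operator, as the largest
subsolution vanishing at `a`. -/
theorem exists_laxOleinik_fixed {c : unitInterval → unitInterval → ℝ}
    (hc : Continuous fun p : unitInterval × unitInterval => c p.1 p.2) {a : unitInterval}
    {W : unitInterval → ℝ} (hW : ∀ x y, W y ≤ W x + (c x y - c a a)) :
    ∃ w : unitInterval → ℝ, Continuous w ∧ (∀ x y, w y ≤ w x + (c x y - c a a)) ∧
      ∀ y, ∃ x, w y = w x + (c x y - c a a) := by
  let S : Set (unitInterval → ℝ) := {w | w a = 0 ∧ ∀ x y, w y ≤ w x + (c x y - c a a)}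
  have : Nonempty S := ⟨⟨fun y => W y - W a, by simp, fun x y => by linarith [hW x y]⟩⟩
  let s : unitInterval → ℝ := fun y => ⨆ w : S, w.1 y
  have hbdd : ∀ y, BddAbove (range fun w : S => w.1 y) := fun y =>
    ⟨c a y - c a a, by rintro _ ⟨w, rfl⟩; simpa [w.2.1] using w.2.2 a y⟩
  have hsS : ∀ x y, s y ≤ s x + (c x y - c a a) := fun x y =>
    ciSup_le fun w => (w.2.2 x y).trans (by gcongr; exact le_ciSup (hbdd x) w)
  have hsa : s a = 0 := by
    have : ∀ w : S, w.1 a = 0 := fun w => w.2.1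
    simp [s, this]
  let T : unitInterval → ℝ := fun y => ⨅ x, (s x + (c x y - c a a))
  have hTb : ∀ y, BddBelow (range fun x => s x + (c x y - c a a)) := fun y =>
    ⟨s y, by rintro _ ⟨x, rfl⟩; exact hsS x y⟩
  have hsT : ∀ y, s y ≤ T y := fun y => le_ciInf fun x => hsS x y
  have hTle : ∀ x y, T y ≤ s x + (c x y - c a a) := fun x y => ciInf_le (hTb y) x
  have hTS : T ∈ S := by
    refine ⟨le_antisymm ?_ ?_, fun x y => (hTle x y).trans (by gcongr; exact hsT x)⟩
    · simpa [hsa] using hTle a a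
    · exact hsa ▸ hsT a
  -- Applying the operator to the largest subsolution gives another normalized subsolution that is
  -- no smaller, so it is fixed.
  have hTs : T = s := funext fun y => le_antisymm (le_ciSup (hbdd y) ⟨T, hTS⟩) (hsT y)
  -- Nothing is known about the regularity of `s`: `T` inherits the modulus of continuity of `c` in
  -- its second variable.
  have hcont : Continuous T := by
    have huc := Metric.uniformContinuous_iff.1 (CompactSpace.uniformContinuous_of_continuous hc)
    have key : ∀ η > 0, ∃ δ > 0, ∀ y z, dist y z < δ → T y ≤ T z + η := by
      intro η hη
      obtain ⟨δ, hδ, H⟩ := huc η hη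
      refine ⟨δ, hδ, fun y z hyz => ?_⟩
      rw [← sub_le_iff_le_add]
      refine le_ciInf fun x => ?_
      have h1 : dist (x, y) (x, z) < δ := by simpa [Prod.dist_eq, hδ] using hyz
      have h2 := H h1
      rw [Real.dist_eq, abs_lt] at h2
      linarith [hTle x y, h2.2]
    rw [Metric.continuous_iff]
    intro y η hη
    obtain ⟨δ, hδ, H⟩ := key (η / 2) (half_pos hη)
    refine ⟨δ, hδ, fun z hz => ?_⟩
    rw [Real.dist_eq, abs_lt]
    have h1 := H z y hz
    have h2 := H y z (by rwa [dist_comm])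
    constructor <;> linarith
  refine ⟨T, hcont, hTS.2, fun y => ?_⟩
  have hcy : Continuous fun x => T x + (c x y - c a a) :=
    hcont.add ((hc.comp (by fun_prop : Continuous fun x => (x, y))).sub continuous_const)
  obtain ⟨x, -, hx⟩ := isCompact_univ.exists_isMinOn univ_nonempty hcy.continuousOn
  refine ⟨x, le_antisymm (hTS.2 x y) ?_⟩
  refine le_ciInf fun t => ?_
  rw [← hTs]
  exact hx (mem_univ t)

theorem hasUniqueCalibratedSubaction_of_cost {c : unitInterval → unitInterval → ℝ}
    (hc : Continuous fun p : unitInterval × unitInterval => c p.1 p.2)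
    {U : unitInterval → ℝ} (hU : Continuous U)
    (hlt : ∀ x y, x ≠ y → c y y - U y < c x y - U x)
    (hmin : ∃ a, ∀ b, b ≠ a → c a a < c b b) :
    HasUniqueCalibratedSubaction fun x => c (x 0) (x 1) := by
  obtain ⟨a, ha⟩ := hmin
  have hle : ∀ x y, c y y - U y ≤ c x y - U x := fun x y => by
    rcases eq_or_ne x y with rfl | hne
    · exact le_rfl
    · exact (hlt x y hne).le
  have hale : ∀ y, c a a ≤ c y y := fun y => by
    rcases eq_or_ne y a with rfl | hne
    · exact le_rfl
    · exact (ha y hne).le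
  have hs : IsStrictSubaction (fun x : X => c (x 0) (x 1)) (fun x => -U (x 0)) a := by
    refine ⟨hc.comp (by fun_prop : Continuous fun x : X => (x 0, x 1)), by fun_prop,
      fun x => ?_, fun x hx => ?_⟩
    · simp only [constSeq, shift, zero_add]
      linarith [hle (x 0) (x 1), hale (x 1)]
    · simp only [constSeq, shift, zero_add] at hx
      have h1 : x 0 = x 1 := by
        by_contra hne
        linarith [hlt _ _ hne, hale (x 1)]
      by_contra hne
      rw [← h1] at hx
      linarith [ha _ hne]
  obtain ⟨w, hwc, hw, hwe⟩ := exists_laxOleinik_fixed hc (a := a) (W := fun x => -U x)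
    fun x y => by linarith [hle x y, hale y]
  refine hs.hasUniqueCalibratedSubaction (v := fun x => w (x 0))
    ⟨⟨by fun_prop, fun x => ?_⟩, fun x => ⟨?_, ?_⟩⟩
  · rw [hs.optAvg_eq]
    simp only [constSeq, shift, zero_add]
    linarith [hw (x 0) (x 1)]
  · obtain ⟨t, ht⟩ := hwe (x 0)
    -- The preimage of `x` obtained by prepending the minimizer `t`.
    let y : X := fun n => Nat.casesOn n t x
    refine ⟨y, (rfl : shift y = x), ?_⟩
    rw [hs.optAvg_eq]
    change c t (x 0) + w t = w (x 0) + c a a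
    linarith
  · rintro _ ⟨y, rfl, rfl⟩
    rw [hs.optAvg_eq]
    simp only [constSeq, shift, zero_add]
    linarith [hw (y 0) (y 1)]

/-! ### Stability of nondegenerate minima -/

/-- `f` is of class `C²` on `[0,1]`, with derivatives `f₁` and `f₂`. -/
structure HasC2Derivs (f f₁ f₂ : ℝ → ℝ) : Prop where
  first : ∀ x ∈ Icc (0 : ℝ) 1, HasDerivWithinAt f (f₁ x) (Icc 0 1) x
  second : ∀ x ∈ Icc (0 : ℝ) 1, HasDerivWithinAt f₁ (f₂ x) (Icc 0 1) x
  continuousOn : ContinuousOn f₂ (Icc 0 1)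

theorem deriv_eq_of_mem_interior {f f₁ : ℝ → ℝ} {D : Set ℝ} (hD : D ⊆ Icc 0 1)
    (hf : ∀ x ∈ Icc (0 : ℝ) 1, HasDerivWithinAt f (f₁ x) (Icc 0 1) x) {x : ℝ}
    (hx : x ∈ interior D) : deriv f x = f₁ x :=
  ((hf x (hD (interior_subset hx))).hasDerivAt
    (mem_of_superset (mem_interior_iff_mem_nhds.1 hx) hD)).deriv

theorem strictMonoOn_of_pos {f f₁ : ℝ → ℝ} {D : Set ℝ} (hD : D ⊆ Icc 0 1) (hc : Convex ℝ D)
    (hf : ∀ x ∈ Icc (0 : ℝ) 1, HasDerivWithinAt f (f₁ x) (Icc 0 1) x)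
    (hpos : ∀ x ∈ interior D, 0 < f₁ x) : StrictMonoOn f D :=
  strictMonoOn_of_deriv_pos hc (fun x hx => ((hf x (hD hx)).continuousWithinAt).mono hD)
    fun x hx => by rw [deriv_eq_of_mem_interior hD hf hx]; exact hpos x hx

theorem strictAntiOn_of_neg {f f₁ : ℝ → ℝ} {D : Set ℝ} (hD : D ⊆ Icc 0 1) (hc : Convex ℝ D)
    (hf : ∀ x ∈ Icc (0 : ℝ) 1, HasDerivWithinAt f (f₁ x) (Icc 0 1) x)
    (hneg : ∀ x ∈ interior D, f₁ x < 0) : StrictAntiOn f D :=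
  strictAntiOn_of_deriv_neg hc (fun x hx => ((hf x (hD hx)).continuousWithinAt).mono hD)
    fun x hx => by rw [deriv_eq_of_mem_interior hD hf hx]; exact hneg x hx

namespace HasC2Derivs

variable {f f₁ f₂ : ℝ → ℝ}

theorem continuousOn_zero (h : HasC2Derivs f f₁ f₂) : ContinuousOn f (Icc 0 1) :=
  fun x hx => (h.first x hx).continuousWithinAt

theorem continuousOn_one (h : HasC2Derivs f f₁ f₂) : ContinuousOn f₁ (Icc 0 1) :=
  fun x hx => (h.second x hx).continuousWithinAt

theorem strictConvexOn (h : HasC2Derivs f f₁ f₂) {D : Set ℝ} (hD : D ⊆ Icc 0 1)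
    (hc : Convex ℝ D) (hpos : ∀ x ∈ D, 0 < f₂ x) : StrictConvexOn ℝ D f := by
  refine StrictMonoOn.strictConvexOn_of_deriv hc (h.continuousOn_zero.mono hD) ?_
  have := (strictMonoOn_of_pos hD hc h.second fun x hx => hpos x (interior_subset hx)).mono
    interior_subset
  exact this.congr fun x hx => (deriv_eq_of_mem_interior hD h.first hx).symm

theorem sub_quadratic (h : HasC2Derivs f f₁ f₂) (ε a : ℝ) :
    HasC2Derivs (fun x => f x - ε * (x - a) ^ 2) (fun x => f₁ x - 2 * ε * (x - a))
      (fun x => f₂ x - 2 * ε) := by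
  refine ⟨fun x hx => ?_, fun x hx => ?_, h.continuousOn.sub continuousOn_const⟩
  · refine (h.first x hx).sub ?_
    have := ((((hasDerivAt_id x).sub_const a).pow 2).const_mul ε).hasDerivWithinAt (s := Icc 0 1)
    refine this.congr_deriv ?_
    simp only [id_eq]
    ring
  · refine (h.second x hx).sub ?_
    have := (((hasDerivAt_id x).sub_const a).const_mul (2 * ε)).hasDerivWithinAt (s := Icc 0 1)
    exact this.congr_deriv (mul_one _)

theorem add {g g₁ g₂ : ℝ → ℝ} (h : HasC2Derivs f f₁ f₂) (hg : HasC2Derivs g g₁ g₂) :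
    HasC2Derivs (fun x => f x + g x) (fun x => f₁ x + g₁ x) (fun x => f₂ x + g₂ x) :=
  ⟨fun x hx => (h.first x hx).add (hg.first x hx),
    fun x hx => (h.second x hx).add (hg.second x hx), h.continuousOn.add hg.continuousOn⟩

theorem exists_pos_near {g : ℝ → ℝ} (hg : ContinuousOn g (Icc 0 1)) {a : ℝ}
    (ha : a ∈ Icc (0 : ℝ) 1) (hpos : 0 < g a) :
    ∃ δ > 0, ∀ x ∈ Icc (0 : ℝ) 1 ∩ Icc (a - δ) (a + δ), g a / 2 < g x := by
  have h1 : ∀ᶠ x in 𝓝[Icc 0 1] a, g a / 2 < g x :=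
    (hg a ha).eventually_const_lt (half_lt_self hpos)
  obtain ⟨δ, hδ, H⟩ := Metric.mem_nhdsWithin_iff.1 h1
  refine ⟨δ / 2, half_pos hδ, fun x hx => H ⟨?_, hx.1⟩⟩
  rw [Metric.mem_ball, Real.dist_eq, abs_lt]
  constructor <;> linarith [hx.2.1, hx.2.2]

/-- The second order necessary condition at a minimum point, possibly on the boundary. -/
theorem second_nonneg_of_isMinOn (h : HasC2Derivs f f₁ f₂) {a : ℝ} (ha : a ∈ Icc (0 : ℝ) 1)
    (hmin : ∀ x ∈ Icc (0 : ℝ) 1, f a ≤ f x) (h₁ : f₁ a = 0) : 0 ≤ f₂ a := by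
  by_contra! hneg
  obtain ⟨δ, hδ, H⟩ := exists_pos_near h.continuousOn.neg ha (Pi.neg_apply f₂ a ▸ neg_pos.2 hneg)
  have hN : Icc (0 : ℝ) 1 ∩ Icc (a - δ) (a + δ) ⊆ Icc 0 1 := inter_subset_left
  have hanti := strictAntiOn_of_neg hN ((convex_Icc _ _).inter (convex_Icc _ _)) h.second
    fun x hx => by
      have := H x (interior_subset hx)
      simp only [Pi.neg_apply] at this
      linarith
  have haN : a ∈ Icc (0 : ℝ) 1 ∩ Icc (a - δ) (a + δ) := ⟨ha, by linarith, by linarith⟩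
  -- Near `a` the derivative `f₁` decreases through `0`, so `f` drops strictly on either side; one
  -- moves right unless `a = 1`.
  rcases ha.2.lt_or_eq with ha1 | ha1
  · have hb : a < min 1 (a + δ) := lt_min ha1 (by linarith)
    have hsub : Icc a (min 1 (a + δ)) ⊆ Icc (0 : ℝ) 1 ∩ Icc (a - δ) (a + δ) := fun x hx =>
      ⟨⟨ha.1.trans hx.1, hx.2.trans (min_le_left _ _)⟩, by linarith [hx.1],
        hx.2.trans (min_le_right _ _)⟩
    have := strictAntiOn_of_neg (hsub.trans hN) (convex_Icc _ _) h.first (fun x hx => by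
      rw [interior_Icc] at hx
      rw [← h₁]
      exact hanti haN (hsub (Ioo_subset_Icc_self hx)) hx.1)
    exact absurd (this (left_mem_Icc.2 hb.le) (right_mem_Icc.2 hb.le) hb)
      (not_lt.2 (hmin _ (hN (hsub (right_mem_Icc.2 hb.le)))))
  · have hb : max 0 (a - δ) < a := max_lt (by linarith) (by linarith)
    have hsub : Icc (max 0 (a - δ)) a ⊆ Icc (0 : ℝ) 1 ∩ Icc (a - δ) (a + δ) := fun x hx =>
      ⟨⟨(le_max_left _ _).trans hx.1, hx.2.trans ha.2⟩, (le_max_right _ _).trans hx.1,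
        by linarith [hx.2]⟩
    have := strictMonoOn_of_pos (hsub.trans hN) (convex_Icc _ _) h.first (fun x hx => by
      rw [interior_Icc] at hx
      rw [← h₁]
      exact hanti (hsub (Ioo_subset_Icc_self hx)) haN hx.2)
    exact absurd (this (left_mem_Icc.2 hb.le) (right_mem_Icc.2 hb.le) hb)
      (not_lt.2 (hmin _ (hN (hsub (left_mem_Icc.2 hb.le)))))

/-- Around a minimum point with quadratic growth, all `C²`-close functions have at most one
minimum point. -/
theorem exists_near_injective (h : HasC2Derivs f f₁ f₂) {a ε : ℝ} (ha : a ∈ Icc (0 : ℝ) 1)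
    (hε : 0 < ε) (hmin : ∀ x ∈ Icc (0 : ℝ) 1, f a + ε * (x - a) ^ 2 ≤ f x) :
    ∃ δ > 0, ∃ η > 0, ∀ g g₁ g₂, HasC2Derivs g g₁ g₂ →
      (∀ x ∈ Icc (0 : ℝ) 1, |g₁ x - f₁ x| ≤ η ∧ |g₂ x - f₂ x| ≤ η) →
      ∀ x ∈ Icc (0 : ℝ) 1 ∩ Icc (a - δ) (a + δ), ∀ y ∈ Icc (0 : ℝ) 1 ∩ Icc (a - δ) (a + δ),
        (∀ z ∈ Icc (0 : ℝ) 1, g x ≤ g z) → (∀ z ∈ Icc (0 : ℝ) 1, g y ≤ g z) → x = y := by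
  have hconv : ∀ δ, Convex ℝ (Icc (0 : ℝ) 1 ∩ Icc (a - δ) (a + δ)) := fun δ =>
    (convex_Icc _ _).inter (convex_Icc _ _)
  have hsub : ∀ δ, Icc (0 : ℝ) 1 ∩ Icc (a - δ) (a + δ) ⊆ Icc 0 1 := fun δ => inter_subset_left
  -- A nonzero derivative is possible only at an endpoint; nearby functions are then strictly
  -- monotone on the window. If `f₁ a = 0`, quadratic growth gives `f₂ a ≥ 2ε`, and they are
  -- strictly convex there.
  rcases lt_trichotomy (f₁ a) 0 with h₁ | h₁ | h₁
  · obtain ⟨δ, hδ, H⟩ := exists_pos_near h.continuousOn_one.neg ha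
      (Pi.neg_apply f₁ a ▸ neg_pos.2 h₁)
    refine ⟨δ, hδ, -f₁ a / 2, by linarith, fun g g₁ g₂ hg hgf x hx y hy hgx hgy => ?_⟩
    refine (strictAntiOn_of_neg (hsub δ) (hconv δ) hg.first fun z hz => ?_).injOn hx hy
      (le_antisymm (hgx y hy.1) (hgy x hx.1))
    have h2 := H z (interior_subset hz)
    have h3 := (abs_le.1 (hgf z (hsub δ (interior_subset hz))).1).2
    simp only [Pi.neg_apply] at h2
    linarith
  · have h₂ : 0 < f₂ a := by
      have := (h.sub_quadratic ε a).second_nonneg_of_isMinOn ha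
        (fun x hx => by simpa using le_sub_iff_add_le.2 (hmin x hx)) (by simp [h₁])
      linarith
    obtain ⟨δ, hδ, H⟩ := exists_pos_near h.continuousOn ha h₂
    refine ⟨δ, hδ, f₂ a / 2, by linarith, fun g g₁ g₂ hg hgf x hx y hy hgx hgy => ?_⟩
    refine (hg.strictConvexOn (hsub δ) (hconv δ) fun z hz => ?_).eq_of_isMinOn
      (fun z hz => hgx z hz.1) (fun z hz => hgy z hz.1) hx hy
    linarith [H z hz, (abs_le.1 (hgf z hz.1).2).1]
  · obtain ⟨δ, hδ, H⟩ := exists_pos_near h.continuousOn_one ha h₁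
    refine ⟨δ, hδ, f₁ a / 2, by linarith, fun g g₁ g₂ hg hgf x hx y hy hgx hgy => ?_⟩
    refine (strictMonoOn_of_pos (hsub δ) (hconv δ) hg.first fun z hz => ?_).injOn hx hy
      (le_antisymm (hgx y hy.1) (hgy x hx.1))
    linarith [H z (interior_subset hz),
      (abs_le.1 (hgf z (hsub δ (interior_subset hz))).1).1]

/-- A minimum point with quadratic growth remains unique under `C²`-small perturbations. -/
theorem exists_stable_min (h : HasC2Derivs f f₁ f₂) {a ε : ℝ} (ha : a ∈ Icc (0 : ℝ) 1)
    (hε : 0 < ε) (hmin : ∀ x ∈ Icc (0 : ℝ) 1, f a + ε * (x - a) ^ 2 ≤ f x) :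
    ∃ η > 0, ∀ g g₁ g₂, HasC2Derivs g g₁ g₂ →
      (∀ x ∈ Icc (0 : ℝ) 1, |g x - f x| < η ∧ |g₁ x - f₁ x| < η ∧ |g₂ x - f₂ x| < η) →
      ∃ b ∈ Icc (0 : ℝ) 1, ∀ x ∈ Icc (0 : ℝ) 1, x ≠ b → g b < g x := by
  obtain ⟨δ, hδ, η, hη, H⟩ := h.exists_near_injective ha hε hmin
  -- Outside the window `f` exceeds `f a` by at least `ε δ²`, which two errors smaller than half of
  -- it cannot cancel; so every minimum point of `g` lies inside.
  refine ⟨min η (ε * δ ^ 2 / 2), lt_min hη (by positivity), fun g g₁ g₂ hg hgf => ?_⟩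
  have hloc : ∀ x ∈ Icc (0 : ℝ) 1, (∀ z ∈ Icc (0 : ℝ) 1, g x ≤ g z) →
      x ∈ Icc (0 : ℝ) 1 ∩ Icc (a - δ) (a + δ) := by
    refine fun x hx hgx => ⟨hx, ?_⟩
    by_contra hcon
    have h1 := (abs_lt.1 ((hgf x hx).1.trans_le (min_le_right _ _))).1
    have h2 := (abs_lt.1 ((hgf a ha).1.trans_le (min_le_right _ _))).2
    have h3 : δ ^ 2 ≤ (x - a) ^ 2 := by
      rw [sq_le_sq, abs_of_pos hδ]
      by_contra! hlt
      rw [abs_lt] at hlt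
      exact hcon ⟨by linarith, by linarith⟩
    have h4 := mul_le_mul_of_nonneg_left h3 hε.le
    linarith [hmin x hx, hgx a ha]
  obtain ⟨b, hb, hbmin⟩ := isCompact_Icc.exists_isMinOn (nonempty_Icc.2 zero_le_one)
    hg.continuousOn_zero
  refine ⟨b, hb, fun x hx hne => (hbmin hx).lt_of_ne fun heq => hne ?_⟩
  have hxmin : ∀ z ∈ Icc (0 : ℝ) 1, g x ≤ g z := fun z hz => heq ▸ hbmin hz
  exact H g g₁ g₂ hg (fun z hz => ⟨((hgf z hz).2.1.trans_le (min_le_left _ _)).le,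
    ((hgf z hz).2.2.trans_le (min_le_left _ _)).le⟩) x (hloc x hx hxmin) b
    (hloc b hb hbmin) hxmin hbmin

end HasC2Derivs

/-! ### `C^r` maps along a line, and their perturbations -/

theorem ext0_of_mem {E : Type*} {K : Set E} (f : K → ℝ) {x : E} (hx : x ∈ K) :
    ext0 f x = f ⟨x, hx⟩ :=
  ext0_coe f ⟨x, hx⟩

namespace CrMap

variable {E : Type*} [NormedAddCommGroup E] [NormedSpace ℝ E] {r : ℕ} {K : Set E}

theorem hasC2Derivs_line [hK : Fact (UniqueDiffOn ℝ K)] (hr : 2 ≤ r) (f : CrMap r K) {v : E}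
    (hv : MapsTo (fun t : ℝ => t • v) (Icc 0 1) K) :
    HasC2Derivs (fun t => ext0 f.1 (t • v)) (fun t => fderivWithin ℝ (ext0 f.1) K (t • v) v)
      (fun t => fderivWithin ℝ (fderivWithin ℝ (ext0 f.1) K) K (t • v) v v) := by
  have h2 : ContDiffOn ℝ 2 (ext0 f.1) K := f.2.of_le (by exact_mod_cast hr)
  have h1 : ContDiffOn ℝ 1 (fderivWithin ℝ (ext0 f.1) K) K :=
    h2.fderivWithin hK.out (by norm_num)
  have h0 : ContDiffOn ℝ 0 (fderivWithin ℝ (fderivWithin ℝ (ext0 f.1) K) K) K :=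
    h1.fderivWithin hK.out (by norm_num)
  have hl : ∀ t, HasDerivWithinAt (fun t : ℝ => t • v) v (Icc 0 1) t := fun t => by
    simpa using ((hasDerivAt_id t).smul_const v).hasDerivWithinAt
  refine ⟨fun t ht => ?_, fun t ht => ?_, ?_⟩
  · exact ((h2.differentiableOn (by norm_num)) _ (hv ht)).hasFDerivWithinAt.comp_hasDerivWithinAt
      t (hl t) hv
  · have := ((h1.differentiableOn (by norm_num)) _ (hv ht)).hasFDerivWithinAt
      |>.comp_hasDerivWithinAt t (hl t) hv
    simpa using this.clm_apply (hasDerivWithinAt_const t (Icc 0 1) v)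
  · have := h0.continuousOn.comp (f := fun t : ℝ => t • v) (by fun_prop) hv
    exact (this.clm_apply continuousOn_const).clm_apply continuousOn_const

/-! ### Pointwise control of derivatives by the `C^r` distance -/

section

variable [hK : Fact (UniqueDiffOn ℝ K)] [CompactSpace K]

theorem norm_iteratedFDerivWithin_sub_le (f g : CrMap r K) {k : ℕ} (hk : k ≤ r) {x : E}
    (hx : x ∈ K) :
    ‖iteratedFDerivWithin ℝ k (ext0 f.1) K x - iteratedFDerivWithin ℝ k (ext0 g.1) K x‖
      ≤ dist f g := by
  rw [← dist_eq_norm]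
  exact (ContinuousMap.dist_apply_le_dist (f := f.jet ⟨k, by omega⟩) (g := g.jet ⟨k, by omega⟩)
    ⟨x, hx⟩).trans (dist_le_pi_dist f.jet g.jet ⟨k, by omega⟩)

theorem abs_sub_le_dist (f g : CrMap r K) {x : E} (hx : x ∈ K) :
    |ext0 f.1 x - ext0 g.1 x| ≤ dist f g := by
  -- Order zero: the multilinear map has no variables, so its argument is a dummy and the product of
  -- norms is empty.
  refine le_trans (le_of_eq ?_) ((ContinuousMultilinearMap.le_opNorm _ (fun _ => 0)).trans
    (mul_le_mul_of_nonneg_right (norm_iteratedFDerivWithin_sub_le f g (Nat.zero_le r) hx)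
      (by positivity)) |>.trans (by simp : _ ≤ dist f g))
  simp

theorem abs_fderivWithin_sub_le_dist (hr : 1 ≤ r) (f g : CrMap r K) {x : E} (hx : x ∈ K) {v : E}
    (hv : ‖v‖ = 1) :
    |fderivWithin ℝ (ext0 f.1) K x v - fderivWithin ℝ (ext0 g.1) K x v| ≤ dist f g := by
  have := (ContinuousMultilinearMap.le_opNorm (iteratedFDerivWithin ℝ 1 (ext0 f.1) K x -
    iteratedFDerivWithin ℝ 1 (ext0 g.1) K x) (fun _ => v)).trans
    (mul_le_mul_of_nonneg_right (norm_iteratedFDerivWithin_sub_le f g hr hx) (by positivity))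
  simpa [hv, iteratedFDerivWithin_one_apply (hK.out x hx)] using this

theorem abs_fderivWithin_fderivWithin_sub_le_dist (hr : 2 ≤ r) (f g : CrMap r K) {x : E}
    (hx : x ∈ K) {v : E} (hv : ‖v‖ = 1) :
    |fderivWithin ℝ (fderivWithin ℝ (ext0 f.1) K) K x v v -
      fderivWithin ℝ (fderivWithin ℝ (ext0 g.1) K) K x v v| ≤ dist f g := by
  have := (ContinuousMultilinearMap.le_opNorm (iteratedFDerivWithin ℝ 2 (ext0 f.1) K x -
    iteratedFDerivWithin ℝ 2 (ext0 g.1) K x) (fun _ => v)).trans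
    (mul_le_mul_of_nonneg_right (norm_iteratedFDerivWithin_sub_le f g hr hx) (by positivity))
  simpa [hv, iteratedFDerivWithin_two_apply _ hK.out hx] using this

end

/-- The perturbation `f + ε p` of `f`. -/
noncomputable def perturb (f : CrMap r K) {p : E → ℝ} (hp : ContDiff ℝ r p) (ε : ℝ) :
    CrMap r K :=
  ⟨fun x => f.1 x + ε * p x, (f.2.add ((contDiff_const (c := ε)).mul hp).contDiffOn).congr fun x hx => by
    simp only [ext0_of_mem _ hx]⟩

theorem ext0_perturb (f : CrMap r K) {p : E → ℝ} (hp : ContDiff ℝ r p) (ε : ℝ) {x : E}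
    (hx : x ∈ K) : ext0 (f.perturb hp ε).1 x = ext0 f.1 x + ε * p x := by
  simp only [ext0_of_mem _ hx, perturb]

theorem tendsto_perturb [hK : Fact (UniqueDiffOn ℝ K)] [CompactSpace K] (f : CrMap r K)
    {p : E → ℝ} (hp : ContDiff ℝ r p) :
    Tendsto (fun ε => f.perturb hp ε) (𝓝[>] 0) (𝓝 f) := by
  have hind : IsInducing (CrMap.jet : CrMap r K → _) := ⟨rfl⟩
  let q : CrMap r K := ⟨fun x => p x, hp.contDiffOn.congr fun x hx => ext0_of_mem _ hx⟩
  have hjet : ∀ ε, (f.perturb hp ε).jet = f.jet + ε • q.jet := by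
    refine fun ε => funext fun k => ContinuousMap.ext fun x => ?_
    have hk : ((k : ℕ) : WithTop ℕ∞) ≤ r := by exact_mod_cast Nat.lt_succ_iff.1 k.2
    have hc : EqOn (ext0 (f.perturb hp ε).1) (ext0 f.1 + ε • ext0 q.1) K := fun y hy => by
      rw [ext0_perturb _ _ _ hy]
      simp [ext0_of_mem _ hy, q]
    have hf := (f.2 x x.2).of_le hk
    have hq := (q.2 x x.2).of_le hk
    change iteratedFDerivWithin ℝ k (ext0 (f.perturb hp ε).1) K x =
      iteratedFDerivWithin ℝ k (ext0 f.1) K x + ε • iteratedFDerivWithin ℝ k (ext0 q.1) K x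
    have hq' : ContDiffWithinAt ℝ k (ε • ext0 q.1) K x := hq.const_smul ε
    exact (iteratedFDerivWithin_congr hc x.2 _).trans
      ((iteratedFDerivWithin_add_apply hf hq' hK.out x.2).trans
        (congrArg _ (iteratedFDerivWithin_const_smul_apply hq hK.out x.2)))
  rw [hind.tendsto_nhds_iff]
  have : Tendsto (fun ε : ℝ => f.jet + ε • q.jet) (𝓝 0) (𝓝 (f.jet + (0 : ℝ) • q.jet)) :=
    tendsto_const_nhds.add (tendsto_id.smul_const _)
  have h0 : f.jet + (0 : ℝ) • q.jet = f.jet := by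
    funext k
    ext1 x
    simp
  rw [h0] at this
  exact (this.mono_left nhdsWithin_le_nhds).congr fun ε => (hjet ε).symm

/-- Stability, in the `C^r`-topology, of a minimum point with quadratic growth along a segment. -/
theorem exists_stable_min_line [hK : Fact (UniqueDiffOn ℝ K)] [CompactSpace K] (hr : 2 ≤ r)
    (f : CrMap r K) {v : E} (hv : MapsTo (fun t : ℝ => t • v) (Icc 0 1) K) (hv1 : ‖v‖ = 1)
    {F F₁ F₂ : ℝ → ℝ} (hF : HasC2Derivs F F₁ F₂) {a ε : ℝ}
    (ha : a ∈ Icc (0 : ℝ) 1) (hε : 0 < ε)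
    (hmin : ∀ x ∈ Icc (0 : ℝ) 1,
      ext0 f.1 (a • v) + F a + ε * (x - a) ^ 2 ≤ ext0 f.1 (x • v) + F x) :
    ∀ᶠ g : CrMap r K in 𝓝 f, ∃ b ∈ Icc (0 : ℝ) 1, ∀ x ∈ Icc (0 : ℝ) 1, x ≠ b →
      ext0 g.1 (b • v) + F b < ext0 g.1 (x • v) + F x := by
  have hadd : ∀ g : CrMap r K, _ := fun g => (hasC2Derivs_line hr g hv).add hF
  obtain ⟨η, hη, H⟩ := (hadd f).exists_stable_min ha hε hmin
  filter_upwards [Metric.ball_mem_nhds f hη] with g hg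
  refine H _ _ _ (hadd g) fun x hx => ⟨?_, ?_, ?_⟩ <;>
    simp only [add_sub_add_right_eq_sub]
  · exact (abs_sub_le_dist g f (hv hx)).trans_lt hg
  · exact (abs_fderivWithin_sub_le_dist (by omega) g f (hv hx) hv1).trans_lt hg
  · exact (abs_fderivWithin_fderivWithin_sub_le_dist hr g f (hv hx) hv1).trans_lt hg

end CrMap

/-- The function `f + F` has a unique minimum point on the segment `[0,1] v`. -/
def HasUniqueMinLine {E : Type*} [NormedAddCommGroup E] [NormedSpace ℝ E] {r : ℕ} {K : Set E}
    (v : E) (F : ℝ → ℝ) (g : CrMap r K) : Prop :=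
  ∃ b ∈ Icc (0 : ℝ) 1, ∀ x ∈ Icc (0 : ℝ) 1, x ≠ b →
    ext0 g.1 (b • v) + F b < ext0 g.1 (x • v) + F x

/-- Here `a` is any minimum point of the unperturbed function on the segment; the added `ε (t - a)²`
is exactly the growth required for stability. -/
theorem CrMap.exists_perturb_stable {E : Type*} [NormedAddCommGroup E] [NormedSpace ℝ E] {r : ℕ}
    {K : Set E} [Fact (UniqueDiffOn ℝ K)] [CompactSpace K] (hr : 2 ≤ r) (f : CrMap r K)
    {v : E} (hv : MapsTo (fun t : ℝ => t • v) (Icc 0 1) K) (hv1 : ‖v‖ = 1) {F F₁ F₂ : ℝ → ℝ}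
    (hF : HasC2Derivs F F₁ F₂) :
    ∃ a : ℝ, ∀ (p : E → ℝ) (hp : ContDiff ℝ r p), (∀ t : ℝ, p (t • v) = (t - a) ^ 2) →
      ∀ ε > 0, ∀ᶠ g in 𝓝 (f.perturb hp ε), HasUniqueMinLine v F g := by
  obtain ⟨a, ha, hmin⟩ := isCompact_Icc.exists_isMinOn (nonempty_Icc.2 zero_le_one)
    ((CrMap.hasC2Derivs_line hr f hv).add hF).continuousOn_zero
  refine ⟨a, fun p hp hpv ε hε => exists_stable_min_line hr _ hv hv1 hF ha hε fun x hx => ?_⟩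
  rw [CrMap.ext0_perturb _ _ _ (hv ha), CrMap.ext0_perturb _ _ _ (hv hx), hpv, hpv]
  have := hmin hx
  simp only [mem_ofPred_eq] at this
  linarith

/-! ### The twist condition -/

section Twist

variable {r : ℕ}

theorem CrMap.hasDerivWithinAt_fst (hr : 1 ≤ r) (h : CrMap r square) {s t : ℝ}
    (hs : s ∈ Icc (0 : ℝ) 1) (ht : t ∈ Icc (0 : ℝ) 1) :
    HasDerivWithinAt (fun s => ext0 h.1 (s, t)) (fderivWithin ℝ (ext0 h.1) square (s, t) (1, 0))
      (Icc 0 1) s := by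
  have h1 : DifferentiableOn ℝ (ext0 h.1) square :=
    h.2.differentiableOn (by exact_mod_cast (by omega : r ≠ 0))
  exact (h1 (s, t) ⟨hs, ht⟩).hasFDerivWithinAt.comp_hasDerivWithinAt (f := fun s => (s, t)) s
    ((hasDerivWithinAt_id s _).prodMk (hasDerivWithinAt_const s _ t)) fun x hx => ⟨hx, ht⟩

theorem CrMap.D1_eq (hr : 1 ≤ r) (h : CrMap r square) {s t : ℝ}
    (hs : s ∈ Icc (0 : ℝ) 1) (ht : t ∈ Icc (0 : ℝ) 1) :
    D1 (ext0 h.1) (s, t) = fderivWithin ℝ (ext0 h.1) square (s, t) (1, 0) :=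
  (h.hasDerivWithinAt_fst hr hs ht).derivWithin (uniqueDiffOn_Icc_zero_one s hs)

theorem CrMap.continuousOn_D1 (hr : 1 ≤ r) (h : CrMap r square) :
    ContinuousOn (D1 (ext0 h.1)) square := by
  have h1 : ContinuousOn (fderivWithin ℝ (ext0 h.1) square) square :=
    h.2.continuousOn_fderivWithin (uniqueDiffOn_Icc_zero_one.prod uniqueDiffOn_Icc_zero_one)
      (by exact_mod_cast hr)
  exact (h1.clm_apply continuousOn_const).congr fun p hp => h.D1_eq hr hp.1 hp.2

theorem strictAntiOn_D1 (hr : 1 ≤ r) (h : TwistSpace r) {s : ℝ} (hs : s ∈ Icc (0 : ℝ) 1) :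
    StrictAntiOn (fun t => D1 (ext0 h.1.1) (s, t)) (Icc 0 1) := by
  refine strictAntiOn_of_deriv_neg (convex_Icc _ _) ?_ fun t ht => ?_
  · exact (h.1.continuousOn_D1 hr).comp (f := fun t => (s, t)) (by fun_prop)
      fun t ht => ⟨hs, ht⟩
  · have h2 := h.2 (s, t) ⟨hs, interior_subset ht⟩
    rwa [D2, derivWithin_of_mem_nhds (mem_interior_iff_mem_nhds.1 ht)] at h2

/-- The twist condition provides a strict reduction to the diagonal. -/
theorem exists_reduction (hr : 1 ≤ r) (h : TwistSpace r) :
    ∃ U : unitInterval → ℝ, Continuous U ∧ ∀ x y : unitInterval, x ≠ y →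
      ext0 h.1.1 ((y : ℝ), (y : ℝ)) - U y < ext0 h.1.1 ((x : ℝ), (y : ℝ)) - U x := by
  -- Projecting to `[0,1]` extends the diagonal derivative continuously to the line, so its
  -- primitive is differentiable everywhere.
  let Q : ℝ → ℝ := fun s =>
    D1 (ext0 h.1.1) ((projIcc (0 : ℝ) 1 zero_le_one s : ℝ), (projIcc (0 : ℝ) 1 zero_le_one s : ℝ))
  have hQ : Continuous Q := (h.1.continuousOn_D1 hr).comp_continuous (by fun_prop)
    fun s => ⟨Subtype.coe_prop _, Subtype.coe_prop _⟩
  have hQe : ∀ s ∈ Icc (0 : ℝ) 1, Q s = D1 (ext0 h.1.1) (s, s) := fun s hs => by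
    simp only [Q, projIcc_of_mem zero_le_one hs]
  let U : ℝ → ℝ := fun y => ∫ s in (0 : ℝ)..y, Q s
  have hU : ∀ x, HasDerivAt U (Q x) x := fun x => (hQ.integral_hasStrictDerivAt 0 x).hasDerivAt
  have hUc : Continuous U := continuous_iff_continuousAt.2 fun x => (hU x).continuousAt
  refine ⟨fun y => U y, hUc.comp continuous_subtype_val, fun x y hne => ?_⟩
  have hF : ∀ s ∈ Icc (0 : ℝ) 1, HasDerivWithinAt (fun s => ext0 h.1.1 (s, (y : ℝ)) - U s)
      (D1 (ext0 h.1.1) (s, y) - D1 (ext0 h.1.1) (s, s)) (Icc 0 1) s := fun s hs => by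
    rw [← hQe s hs, h.1.D1_eq hr hs y.2]
    exact (h.1.hasDerivWithinAt_fst hr hs y.2).sub (hU s).hasDerivWithinAt
  rcases lt_or_gt_of_ne (fun he => hne (Subtype.ext he) : (x : ℝ) ≠ y) with hxy | hxy
  · refine strictAntiOn_of_neg (D := Icc (x : ℝ) y) (Icc_subset_Icc x.2.1 y.2.2) (convex_Icc _ _)
      hF (fun s hs => ?_) (left_mem_Icc.2 hxy.le) (right_mem_Icc.2 hxy.le) hxy
    rw [interior_Icc] at hs
    have hs' : s ∈ Icc (0 : ℝ) 1 := ⟨x.2.1.trans hs.1.le, hs.2.le.trans y.2.2⟩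
    exact sub_neg.2 (strictAntiOn_D1 hr h hs' hs' y.2 hs.2)
  · refine strictMonoOn_of_pos (D := Icc (y : ℝ) x) (Icc_subset_Icc y.2.1 x.2.2) (convex_Icc _ _)
      hF (fun s hs => ?_) (left_mem_Icc.2 hxy.le) (right_mem_Icc.2 hxy.le) hxy
    rw [interior_Icc] at hs
    have hs' : s ∈ Icc (0 : ℝ) 1 := ⟨y.2.1.trans hs.1.le, hs.2.le.trans x.2.2⟩
    exact sub_pos.2 (strictAntiOn_D1 hr h hs' y.2 hs' hs.1)

/-- A perturbation depending on the first coordinate only preserves the twist condition. -/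
theorem twist_perturb (hr : 1 ≤ r) (h : TwistSpace r) {p : ℝ × ℝ → ℝ} (hp : ContDiff ℝ r p)
    {w : ℝ → ℝ} (hpw : ∀ q, p q = w q.1) (ε : ℝ) :
    ∀ q ∈ square, D2 (D1 (ext0 (h.1.perturb hp ε).1)) q < 0 := by
  have hw : Differentiable ℝ w := by
    have : w = fun s => p (s, 0) := funext fun s => (hpw (s, 0)).symm
    rw [this]
    exact (hp.differentiable (by exact_mod_cast (by omega : r ≠ 0))).comp (by fun_prop)
  have hD1 : ∀ q ∈ square, D1 (ext0 (h.1.perturb hp ε).1) q =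
      D1 (ext0 h.1.1) q + ε * derivWithin w (Icc 0 1) q.1 := by
    rintro ⟨s, t⟩ ⟨hs, ht⟩
    have hu := uniqueDiffOn_Icc_zero_one s hs
    have e : EqOn (fun s => ext0 (h.1.perturb hp ε).1 (s, t))
        (fun s => ext0 h.1.1 (s, t) + ε * w s) (Icc 0 1) := fun x hx => by
      simp only [CrMap.ext0_perturb _ _ _ (show (x, t) ∈ square from ⟨hx, ht⟩), hpw]
    have h1 := (h.1.hasDerivWithinAt_fst hr hs ht).differentiableWithinAt.hasDerivWithinAt
    have h2 := ((hw s).differentiableWithinAt (s := Icc 0 1)).hasDerivWithinAt.const_mul ε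
    exact ((h1.add h2).congr e (e hs)).derivWithin hu
  rintro ⟨s, t⟩ ⟨hs, ht⟩
  have e : EqOn (fun t => D1 (ext0 (h.1.perturb hp ε).1) (s, t))
      (fun t => D1 (ext0 h.1.1) (s, t) + ε * derivWithin w (Icc 0 1) s) (Icc 0 1) :=
    fun x hx => hD1 (s, x) ⟨hs, hx⟩
  have : D2 (D1 (ext0 (h.1.perturb hp ε).1)) (s, t) = D2 (D1 (ext0 h.1.1)) (s, t) := by
    simp only [D2]
    rw [derivWithin_congr e (e ht), derivWithin_add_const]
  rw [this]
  exact h.2 (s, t) ⟨hs, ht⟩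

theorem mapsTo_diagonal :
    MapsTo (fun t : ℝ => t • ((1 : ℝ), (1 : ℝ))) (Icc 0 1) square := fun t ht => by
  simpa using ht

/-- Adding `V` to both the cost and `U` leaves the reduction inequality unchanged, so only the
diagonal minimum feels `V`. -/
theorem hasUniqueCalibratedSubaction_perturbedPotential (hr : 1 ≤ r) (h : TwistSpace r)
    {V : unitInterval → ℝ} (hV : Continuous V)
    (hmin : ∃ b ∈ Icc (0 : ℝ) 1, ∀ x ∈ Icc (0 : ℝ) 1, x ≠ b →
      ext0 h.1.1 (b, b) + ext0 V b < ext0 h.1.1 (x, x) + ext0 V x) :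
    HasUniqueCalibratedSubaction fun x => potential h.1 x + V (x 0) := by
  obtain ⟨U, hU, hlt⟩ := exists_reduction hr h
  have hc : Continuous fun p : unitInterval × unitInterval =>
      ext0 h.1.1 ((p.1 : ℝ), (p.2 : ℝ)) + V p.1 :=
    (h.1.2.continuousOn.comp_continuous (by fun_prop) fun p => ⟨p.1.2, p.2.2⟩).add
      (hV.comp continuous_fst)
  have := hasUniqueCalibratedSubaction_of_cost
    (c := fun x y => ext0 h.1.1 ((x : ℝ), (y : ℝ)) + V x) hc (U := fun x => U x + V x)
    (hU.add hV) (fun x y hne => by linarith [hlt x y hne]) (by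
      obtain ⟨b, hb, H⟩ := hmin
      refine ⟨⟨b, hb⟩, fun x hx => ?_⟩
      have := H x x.2 fun he => hx (Subtype.ext he)
      rwa [ext0_coe V x, ext0_of_mem V hb] at this)
  refine (funext fun x => ?_ : (fun x : X => potential h.1 x + V (x 0)) = _) ▸ this
  exact congrArg (· + V (x 0)) (ext0_of_mem h.1.1 (x := ((x 0 : ℝ), (x 1 : ℝ)))
    ⟨(x 0).2, (x 1).2⟩).symm

end Twist

end XYModel

/-! ### Genericity in the two function spaces -/

open XYModel
theorem mainTheorem9 (r : ℕ) (hr : 2 ≤ r) :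
    (∃ O : Set (TwistSpace r), IsOpen O ∧ Dense O ∧
      ∀ h ∈ O, HasUniqueCalibratedSubaction (potential h.1)) ∧
    (∀ h : TwistSpace r, ∃ 𝒱 : Set (CrMap r (Icc (0 : ℝ) 1)), IsOpen 𝒱 ∧ Dense 𝒱 ∧
      ∀ V ∈ 𝒱, HasUniqueCalibratedSubaction (perturbedPotential h.1 V)) := by
  have hr1 : 1 ≤ r := by omega
  -- Both open sets are interiors of the unique-minimum sets, so density requires approximations
  -- with a stable minimum. In the first, the diagonal of `h` varies; in the second, `V` varies and
  -- the diagonal of `h` is the fixed summand.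
  refine ⟨⟨interior {h | HasUniqueMinLine ((1 : ℝ), (1 : ℝ)) (fun _ => 0) h.1}, isOpen_interior,
    fun h => ?_, fun h hh => ?_⟩, fun h => ⟨interior {V | HasUniqueMinLine (1 : ℝ)
      (fun t => ext0 h.1.1 (t • ((1 : ℝ), (1 : ℝ)))) V}, isOpen_interior, fun V => ?_,
      fun V hV => ?_⟩⟩
  · obtain ⟨a, ha⟩ := h.1.exists_perturb_stable hr mapsTo_diagonal (by simp [Prod.norm_def])
      (F := fun _ => 0) (F₁ := fun _ => 0) (F₂ := fun _ => 0)
      ⟨fun x _ => hasDerivWithinAt_const x _ 0, fun x _ => hasDerivWithinAt_const x _ 0,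
        continuousOn_const⟩
    have hp : ContDiff ℝ r fun q : ℝ × ℝ => (q.1 - a) ^ 2 := by fun_prop
    refine mem_closure_of_tendsto (f := fun ε : ℝ => (⟨h.1.perturb hp ε,
      twist_perturb hr1 h hp (w := fun s => (s - a) ^ 2) (fun _ => rfl) ε⟩ : TwistSpace r))
      (tendsto_subtype_rng.2 (h.1.tendsto_perturb hp)) ?_
    filter_upwards [self_mem_nhdsWithin] with ε hε
    rw [mem_interior_iff_mem_nhds]
    exact continuous_subtype_val.continuousAt.eventually (ha _ hp (by simp) ε hε)
  · obtain ⟨b, hb, H⟩ := interior_subset hh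
    have := hasUniqueCalibratedSubaction_perturbedPotential hr1 h (V := fun _ => 0)
      continuous_const ⟨b, hb, fun x hx hne => by
        simpa [ext0_of_mem (fun _ : unitInterval => (0 : ℝ)) hb,
          ext0_of_mem (fun _ : unitInterval => (0 : ℝ)) hx] using H x hx hne⟩
    simpa using this
  · obtain ⟨a, ha⟩ := V.exists_perturb_stable hr (v := (1 : ℝ)) (fun t ht => by simpa using ht)
      (by simp) (h.1.hasC2Derivs_line hr mapsTo_diagonal)
    have hp : ContDiff ℝ r fun s : ℝ => (s - a) ^ 2 := by fun_prop
    refine mem_closure_of_tendsto (V.tendsto_perturb hp) ?_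
    filter_upwards [self_mem_nhdsWithin] with ε hε
    exact mem_interior_iff_mem_nhds.2 (ha _ hp (by simp) ε hε)
  · obtain ⟨b, hb, H⟩ := interior_subset hV
    have hVc : Continuous V.1 := by
      refine (continuousOn_iff_continuous_domRestrict.1 V.2.continuousOn).congr fun x => ?_
      exact ext0_coe _ x
    exact hasUniqueCalibratedSubaction_perturbedPotential hr1 h hVc ⟨b, hb, fun x hx hne => by
      simpa [add_comm] using H x hx hne⟩
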